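/- Let $q$ be a power of $2$, let $m\ge 2$, and let $V$ be a $2m$-dimensional vector space over $\mathbb F_q$ with a nondegenerate symplectic form $\beta$ and a basis $e_1,\dots,e_m,f_1,\dots,f_m$ such that $\beta(e_i,e_j)=\beta(f_i,f_j)=0$ and $\beta(e_i,f_j)=\delta_{ij}$ for all $i,j$. Let $x^2+x+\sigma$ be irreducible over $\mathbb F_q$, and let $Q$ be the quadratic form on $V$ with polar form $\beta$ such that $Q(e_i)=Q(f_i)=0$ for $i<m$, $Q(e_m)=1$ and $Q(f_m)=\sigma$; it has Witt index $m-1$, that is, it is of minus type. Put $G=\mathrm{Sp}(V,\beta)=\mathrm{Sp}_{2m}(q)$ and $K=\mathrm O^-(V,Q)=\mathrm O^-_{2m}(q)$, the group of all linear isometries of $Q$. Let $A=\mathrm P_m[G]$ be the stabilizer of $U=\langle e_1,\dots,e_m\rangle$ in $G$, and let $R=\mathbf O_2(A)$ be the largest normal $2$-subgroup of $A$. Then the stabilizer in $A$ of $\langle f_1,\dots,f_m\rangle$ is a complement of $R$ in $A$, and every complement $C$ of $R$ in $A$ acts faithfully on $U$ as the full group $\mathrm{GL}(U)=\mathrm{GL}_m(q)$.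 Let $C$ be any complement of $R$ in $A$. Call $S\le C$ a Singer cycle of $C$ if it acts on $U$ as the group of multiplications by the nonzero elements of $\mathbb F_{q^m}$, for some identification of $U$ with $\mathbb F_{q^m}$ as $\mathbb F_q$-spaces. Singer cycles of $C$ exist. For every such $S$ put $H=RS$. Then $H$ is a solvable subgroup of $A=\mathrm P_m[G]$, $H=R{:}S$ is a split extension in which $R$ is elementary abelian of order $q^{m(m+1)/2}$ and $S\cong\mathrm{GL}_1(q^m)$, so that $H=q^{m(m+1)/2}{:}\mathrm{GL}_1(q^m)$, and $$\mathrm{Sp}_{2m}(q)=G=HK=\bigl(q^{m(m+1)/2}{:}\mathrm{GL}_1(q^m)\bigr)\,\mathrm O^-_{2m}(q).$$ -/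

import Mathlib

open Polynomial
open scoped Pointwise

universe v

/-- The isometry group of a bilinear form `β`, as a subgroup of `GL(V)`; for a nondegenerate
alternating form this is the symplectic group `Sp(V, β)`. -/
def bilinIsometryGroup {F V : Type*} [Field F] [AddCommGroup V] [Module F V]
    (β : LinearMap.BilinForm F V) : Subgroup (V ≃ₗ[F] V) where
  carrier := {g | ∀ x y, β (g x) (g y) = β x y}
  mul_mem' := by
    intro a b ha hb x y
    exact (ha (b x) (b y)).trans (hb x y)
  one_mem' := fun _ _ => rfl
  inv_mem' := by
    intro a ha x y
    have h := ha (a.symm x) (a.symm y)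
    rw [a.apply_symm_apply, a.apply_symm_apply] at h
    exact h.symm

/-- The general orthogonal group of a quadratic form `Q`: all linear automorphisms of the space
which preserve `Q`. -/
def quadIsometryGroup {F V : Type*} [Field F] [AddCommGroup V] [Module F V]
    (Q : QuadraticForm F V) : Subgroup (V ≃ₗ[F] V) where
  carrier := {g | ∀ x, Q (g x) = Q x}
  mul_mem' := by
    intro a b ha hb x
    exact (ha (b x)).trans (hb x)
  one_mem' := fun _ => rfl
  inv_mem' := by
    intro a ha x
    have h := ha (a.symm x)
    rw [a.apply_symm_apply] at h
    exact h.symm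

/-- The (setwise) stabilizer in `GL(V)` of a subspace `U`. -/
def subspaceStabilizer {F V : Type*} [Field F] [AddCommGroup V] [Module F V]
    (U : Submodule F V) : Subgroup (V ≃ₗ[F] V) where
  carrier := {g | U.map (g : V →ₗ[F] V) = U}
  mul_mem' := by
    intro a b ha hb
    change U.map ((a : V →ₗ[F] V).comp (b : V →ₗ[F] V)) = U
    rw [Submodule.map_comp, show U.map (b : V →ₗ[F] V) = U from hb]
    exact ha
  one_mem' := Submodule.map_id U
  inv_mem' := by
    intro a ha
    change U.map (a.symm : V →ₗ[F] V) = U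
    have h : U.map (a : V →ₗ[F] V) = U := ha
    conv_lhs => rw [← h]
    rw [← Submodule.map_comp]
    simp

/-- `pCore p A` is `O_p(A)`, the largest normal `p`-subgroup of `A`: the subgroup generated by all
normal `p`-subgroups of `A`. -/
def pCore {X : Type*} [Group X] (p : ℕ) (A : Subgroup X) : Subgroup X :=
  sSup {N | N ≤ A ∧ (N.subgroupOf A).Normal ∧ IsPGroup p N}

/-- `A = N : C`, an internal split extension: `N` is normal in `A`, and `C` is a complement of `N`
in `A`. -/
def IsSplitExtension {X : Type*} [Group X] (A N C : Subgroup X) : Prop :=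
  N ≤ A ∧ C ≤ A ∧ (N.subgroupOf A).Normal ∧ N ⊓ C = ⊥ ∧ (A : Set X) = (N : Set X) * (C : Set X)

/-- A subgroup `T` of `GL(U)` is a Singer cycle if, after an identification of the `F`-space `U`
with an extension field `L` of `F` (so that `L` has degree `dim U` over `F`), it consists of
the multiplications by the nonzero elements of `L`. The choice of the identification accounts
for the conjugates. -/
def IsSingerCycle {F : Type*} {U : Type v} [Field F] [AddCommGroup U] [Module F U]
    (T : Subgroup (U ≃ₗ[F] U)) : Prop :=
  ∃ (L : Type v) (_ : Field L) (_ : Algebra F L) (ψ : L ≃ₗ[F] U),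
    ∀ g : U ≃ₗ[F] U, g ∈ T ↔ ∃ a : L, a ≠ 0 ∧ ∀ x : L, g (ψ x) = ψ (a * x)

/-- For a group `C` of linear automorphisms of `V` that is identified with `GL(U)` through its
action on a subspace `U`: the subgroup `S` of `C` is a Singer cycle of `C`, that is, it consists
of those elements of `C` which act on `U` as an element of a Singer cycle of `GL(U)`. -/
def IsSingerCycleVia {F : Type*} {V : Type v} [Field F] [AddCommGroup V] [Module F V]
    (U : Submodule F V) (C S : Subgroup (V ≃ₗ[F] V)) : Prop :=
  S ≤ C ∧ ∃ T : Subgroup (U ≃ₗ[F] U), IsSingerCycle T ∧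
    ∀ g ∈ C, g ∈ S ↔ ∃ t ∈ T, ∀ x : U, g (x : V) = (t x : V)

/-- `Q` has Witt index `k`: the largest dimension of a totally singular subspace is `k`. A
nondegenerate form on a space of dimension `2m` over a finite field is of minus type if its Witt
index is `m - 1`. -/
def HasWittIndex {F V : Type*} [Field F] [AddCommGroup V] [Module F V]
    (Q : QuadraticForm F V) (k : ℕ) : Prop :=
  IsGreatest {d | ∃ W : Submodule F V, (∀ x ∈ W, Q x = 0) ∧ Module.finrank F W = d} k

/-!
Let `U` be the span of the `eᵢ` and `A` its stabilizer in the symplectic group `G`. Since `U` is its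
own orthogonal space, an isometry that is trivial on `U` is also trivial modulo `U`; such isometries
form an elementary abelian `2`-group, in bijection with the symmetric matrices (`isometryFixator`,
`IsSymplecticBasis.card_isometryFixator`). It is all of `O₂(A)`: a normal `2`-subgroup of `A` fixes
a nonzero vector of `U`, and `A` is transitive on the nonzero vectors of `U`, because every
automorphism of `U` extends contragrediently to the span of the `fᵢ`
(`IsSymplecticBasis.exists_extension`, `IsSymplecticBasis.pCore_two`). Consequently restriction to
`U` identifies any complement `C` of `R = O₂(A)` with `GL(U)`, and the Singer cycles of `C` are
copies of the multiplicative group of an extension field of degree `m`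
(`IsSingerCycleVia.exists_field`).

For the factorization `G = HK`, let `g ∈ G`. The forms `Q` and `Q ∘ g⁻¹` both have polar form `β`,
hence are additive on `U`, and their restrictions to `U` are squares of linear forms, which are
nonzero as there is no totally singular subspace of dimension `m`
(`IsMinusForm.finrank_lt_of_singular`). A Singer cycle is transitive on the nonzero linear forms
on `U` (`exists_mul_eq_of_linearForm`), so there is `s ∈ S` such that `Q' = Q ∘ g⁻¹ ∘ s` agrees with
`Q` on `U`. Then `Q = Q' + β(a, ·)²` for some `a ∈ U`, and a symplectic transvection in direction
`a`, which belongs to `R`, carries `Q'` to `Q` provided that `Q(a)` has the form `t + t²`. The image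
of `t ↦ t + t²` has index two in the field (`exists_add_sq_eq_add`); since `Q` and `Q'` are both of
minus type, neither `Q(fₘ)` nor `Q'(fₘ) = Q(fₘ) + Q(a)` lies in this image, so `Q(a)` does
(`IsMinusForm.exists_isometryFixator`).
-/

/-! ### Fields of characteristic two -/

section CharTwo

variable {F : Type*} [Field F] [Finite F] [CharP F 2]

/-- Over a finite field of characteristic two, an additive map that is homogeneous of degree two
is the square of a linear form, since the Frobenius map is bijective. -/
theorem exists_linearMap_sq {M : Type*} [AddCommGroup M] [Module F M] (q : M → F)
    (hadd : ∀ x y, q (x + y) = q x + q y) (hsmul : ∀ (c : F) x, q (c • x) = c ^ 2 * q x) :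
    ∃ μ : M →ₗ[F] F, ∀ x, q x = μ x ^ 2 := by
  have hs : ∀ x : F, (frobeniusEquiv F 2).symm x ^ 2 = x := fun x => by
    rw [← frobeniusEquiv_def, RingEquiv.apply_symm_apply]
  refine ⟨⟨⟨fun x => (frobeniusEquiv F 2).symm (q x), fun x y => ?_⟩, fun c x => ?_⟩, fun x => ?_⟩
  · rw [hadd, map_add]
  · change (frobeniusEquiv F 2).symm (q (c • x)) = c * (frobeniusEquiv F 2).symm (q x)
    rw [hsmul, map_mul, ← frobeniusEquiv_def, RingEquiv.symm_apply_apply]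
  · exact (hs _).symm

/-- The Artin-Schreier map `t ↦ t + t ^ 2` of a finite field of characteristic two has image of
index two, so the sum of two elements outside the image is in the image. -/
theorem exists_add_sq_eq_add {x y : F} (hx : ∀ t : F, t + t ^ 2 ≠ x) (hy : ∀ t : F, t + t ^ 2 ≠ y) :
    ∃ t : F, t + t ^ 2 = x + y := by
  let P : F →+ F :=
    { toFun := fun t => t + t ^ 2
      map_zero' := by simp
      map_add' := fun a b => by rw [CharTwo.add_sq]; abel }
  have hP : ∀ t, P t = t + t ^ 2 := fun _ => rfl
  have hker : (P.ker : Set F) = {0, 1} := by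
    ext t
    have : t + t ^ 2 = t * (t + 1) := by ring
    rw [SetLike.mem_coe, AddMonoidHom.mem_ker, hP, this, mul_eq_zero, CharTwo.add_eq_zero]
    rfl
  have hcard : Nat.card P.ker = 2 := by
    have := Set.ncard_pair (zero_ne_one (α := F))
    rwa [← hker, ← Nat.card_coe_set_eq] at this
  have hindex : P.range.index = 2 := by
    have h1 := P.range.card_mul_index
    have h2 := P.ker.card_mul_index
    rw [AddSubgroup.index_ker, hcard, ← h1, mul_comm] at h2
    exact (Nat.eq_of_mul_eq_mul_left Nat.card_pos h2).symm
  have hmem := AddSubgroup.add_mem_iff_of_index_two hindex (a := x) (b := y)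
  have hx' : x ∉ P.range := fun ⟨t, ht⟩ => hx t ht
  have hy' : y ∉ P.range := fun ⟨t, ht⟩ => hy t ht
  exact hmem.2 (by simp [hx', hy'])

omit [Finite F] in
theorem add_sq_ne_of_irreducible {σ : F} (hσ : Irreducible (X ^ 2 + X + C σ : F[X])) (t : F) :
    t + t ^ 2 ≠ σ := by
  rintro rfl
  have hd : (X ^ 2 + X + C (t + t ^ 2) : F[X]).natDegree = 2 := by compute_degree!
  have := hσ.not_isRoot_of_natDegree_ne_one (by rw [hd]; decide) (x := t)
  apply this
  have h2 := CharTwo.add_self_eq_zero (t + t ^ 2)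
  simp only [IsRoot, eval_add, eval_pow, eval_X, eval_C]
  linear_combination h2

omit [Finite F] in
/-- The binary form `x² + xy + σy²` is anisotropic when `σ` is not of the form `t + t²`. -/
theorem eq_zero_of_sq_add_mul_add {σ x y : F} (hσ : ∀ t : F, t + t ^ 2 ≠ σ)
    (h : x ^ 2 + x * y + σ * y ^ 2 = 0) : x = 0 ∧ y = 0 := by
  have hy : y = 0 := by
    by_contra hy
    apply hσ (x / y)
    have h' : x ^ 2 + x * y = σ * y ^ 2 := CharTwo.add_eq_zero.1 h
    field_simp
    linear_combination h'
  subst hy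
  simpa using h

end CharTwo

/-! ### Symplectic bases -/

/-- The basis `b`, with vectors `eᵢ = b (inl i)` and `fᵢ = b (inr i)`, is symplectic for the
bilinear form `β`. The values `β fᵢ eⱼ` are not recorded, as `β` will be alternating. -/
structure IsSymplecticBasis {F V ι : Type*} [Field F] [AddCommGroup V] [Module F V]
    [DecidableEq ι] (β : LinearMap.BilinForm F V) (b : Module.Basis (ι ⊕ ι) F V) : Prop where
  inl_inl : ∀ i j, β (b (Sum.inl i)) (b (Sum.inl j)) = 0
  inr_inr : ∀ i j, β (b (Sum.inr i)) (b (Sum.inr j)) = 0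
  inl_inr : ∀ i j, β (b (Sum.inl i)) (b (Sum.inr j)) = if i = j then 1 else 0

section SymplecticBasis

variable {F V ι : Type*} [Field F] [AddCommGroup V] [Module F V]

/-- The span of the first half `eᵢ = b (inl i)` of a basis. -/
def spanInl (b : Module.Basis (ι ⊕ ι) F V) : Submodule F V :=
  Submodule.span F (Set.range fun i => b (Sum.inl i))

/-- The span of the second half `fᵢ = b (inr i)` of a basis. -/
def spanInr (b : Module.Basis (ι ⊕ ι) F V) : Submodule F V :=
  Submodule.span F (Set.range fun i => b (Sum.inr i))

theorem inl_mem_spanInl (b : Module.Basis (ι ⊕ ι) F V) (i : ι) : b (Sum.inl i) ∈ spanInl b :=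
  Submodule.subset_span ⟨i, rfl⟩

theorem inr_mem_spanInr (b : Module.Basis (ι ⊕ ι) F V) (i : ι) : b (Sum.inr i) ∈ spanInr b :=
  Submodule.subset_span ⟨i, rfl⟩

variable [Fintype ι]

theorem eq_sum_inl_add_sum_inr (b : Module.Basis (ι ⊕ ι) F V) (x : V) :
    x = ∑ i, b.repr x (Sum.inl i) • b (Sum.inl i) + ∑ i, b.repr x (Sum.inr i) • b (Sum.inr i) := by
  conv_lhs => rw [← b.sum_repr x, Fintype.sum_sum_type]

theorem mem_spanInl_iff_repr (b : Module.Basis (ι ⊕ ι) F V) {x : V} :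
    x ∈ spanInl b ↔ ∀ j, b.repr x (Sum.inr j) = 0 := by
  refine ⟨fun hx j => ?_, fun h => ?_⟩
  · have : spanInl b ≤ LinearMap.ker (b.coord (Sum.inr j)) := by
      refine Submodule.span_le.2 ?_
      rintro _ ⟨i, rfl⟩
      simp
    exact this hx
  · rw [eq_sum_inl_add_sum_inr b x]
    simp only [h, zero_smul, Finset.sum_const_zero, add_zero]
    exact Submodule.sum_mem _ fun i _ => Submodule.smul_mem _ _ (inl_mem_spanInl b i)

theorem mem_spanInr_iff_repr (b : Module.Basis (ι ⊕ ι) F V) {x : V} :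
    x ∈ spanInr b ↔ ∀ j, b.repr x (Sum.inl j) = 0 := by
  refine ⟨fun hx j => ?_, fun h => ?_⟩
  · have : spanInr b ≤ LinearMap.ker (b.coord (Sum.inl j)) := by
      refine Submodule.span_le.2 ?_
      rintro _ ⟨i, rfl⟩
      simp
    exact this hx
  · rw [eq_sum_inl_add_sum_inr b x]
    simp only [h, zero_smul, Finset.sum_const_zero, zero_add]
    exact Submodule.sum_mem _ fun i _ => Submodule.smul_mem _ _ (inr_mem_spanInr b i)

/-- The first half of a basis, as a basis of its span. -/
noncomputable def basisInl (b : Module.Basis (ι ⊕ ι) F V) : Module.Basis ι F (spanInl b) :=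
  Module.Basis.span (b.linearIndependent.comp Sum.inl Sum.inl_injective)

omit [Fintype ι] in
theorem coe_basisInl (b : Module.Basis (ι ⊕ ι) F V) (i : ι) :
    (basisInl b i : V) = b (Sum.inl i) :=
  congrArg Subtype.val
    (Module.Basis.span_apply (b.linearIndependent.comp Sum.inl Sum.inl_injective) i)

theorem finrank_spanInl (b : Module.Basis (ι ⊕ ι) F V) :
    Module.finrank F (spanInl b) = Fintype.card ι :=
  Module.finrank_eq_card_basis (basisInl b)

variable [DecidableEq ι] {β : LinearMap.BilinForm F V} {b : Module.Basis (ι ⊕ ι) F V}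

section Coordinates

variable [CharP F 2] (hb : IsSymplecticBasis β b) (hβ : β.IsAlt)

include hβ in
theorem bilin_comm (x y : V) : β x y = β y x := by
  rw [← hβ.neg_eq, CharTwo.neg_eq]

include hb hβ

omit [Fintype ι] in
theorem IsSymplecticBasis.inr_inl (i j : ι) :
    β (b (Sum.inr i)) (b (Sum.inl j)) = if i = j then 1 else 0 := by
  rw [bilin_comm hβ, hb.inl_inr]
  simp only [eq_comm]

theorem IsSymplecticBasis.apply_inl (x : V) (j : ι) :
    β x (b (Sum.inl j)) = b.repr x (Sum.inr j) := by
  conv_lhs => rw [eq_sum_inl_add_sum_inr b x]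
  simp [hb.inl_inl, hb.inr_inl hβ]

omit [CharP F 2] hβ in
theorem IsSymplecticBasis.apply_inr (x : V) (j : ι) :
    β x (b (Sum.inr j)) = b.repr x (Sum.inl j) := by
  conv_lhs => rw [eq_sum_inl_add_sum_inr b x]
  simp [hb.inr_inr, hb.inl_inr]

theorem IsSymplecticBasis.inl_apply (x : V) (j : ι) :
    β (b (Sum.inl j)) x = b.repr x (Sum.inr j) := by
  rw [bilin_comm hβ, hb.apply_inl hβ]

/-- The span of the `eᵢ` is its own orthogonal space. -/
theorem IsSymplecticBasis.mem_spanInl_iff {x : V} :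
    x ∈ spanInl b ↔ ∀ y ∈ spanInl b, β x y = 0 := by
  refine ⟨fun hx y hy => ?_, fun h => (mem_spanInl_iff_repr b).2 fun j => ?_⟩
  · rw [eq_sum_inl_add_sum_inr b y]
    simp [(mem_spanInl_iff_repr b).1 hx, (mem_spanInl_iff_repr b).1 hy, hb.apply_inl hβ]
  · rw [← hb.apply_inl hβ, h _ (inl_mem_spanInl b j)]

/-- A linear form that vanishes on the span of the `eᵢ` is pairing with a vector of this span. -/
theorem IsSymplecticBasis.exists_eq_apply (δ : V →ₗ[F] F)
    (hδ : ∀ x ∈ spanInl b, δ x = 0) : ∃ a ∈ spanInl b, ∀ x, δ x = β a x := by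
  refine ⟨∑ i, δ (b (Sum.inr i)) • b (Sum.inl i),
    Submodule.sum_mem _ fun i _ => Submodule.smul_mem _ _ (inl_mem_spanInl b i), fun x => ?_⟩
  conv_lhs => rw [eq_sum_inl_add_sum_inr b x]
  simp [hδ _ (inl_mem_spanInl b _), hb.inl_apply hβ, mul_comm]

end Coordinates

/-! ### Isometries of a symplectic space -/

omit [Fintype ι] [DecidableEq ι] in
/-- A linear endomorphism preserving a nondegenerate form on a finite-dimensional space is
bijective. -/
theorem exists_mem_bilinIsometryGroup [FiniteDimensional F V] (hβ' : β.Nondegenerate)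
    (φ : V →ₗ[F] V) (h : ∀ x y, β (φ x) (φ y) = β x y) :
    ∃ g ∈ bilinIsometryGroup β, ∀ x, g x = φ x := by
  have hinj : Function.Injective φ := by
    rw [injective_iff_map_eq_zero]
    intro x hx
    refine hβ'.1 x fun y => ?_
    rw [← h, hx, map_zero, LinearMap.zero_apply]
  exact ⟨LinearEquiv.ofInjectiveEndo φ hinj, h, fun _ => rfl⟩

omit [Fintype ι] [DecidableEq ι] in
theorem map_map_eq_of_basis (φ : V →ₗ[F] V)
    (h : ∀ i j, β (φ (b i)) (φ (b j)) = β (b i) (b j)) (x y : V) : β (φ x) (φ y) = β x y := by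
  have : β.compl₁₂ φ φ = β := b.ext fun i => b.ext fun j => h i j
  exact LinearMap.congr_fun (LinearMap.congr_fun this x) y

end SymplecticBasis

/-! ### The Levi factor -/

section Levi

variable {F V ι : Type*} [Field F] [AddCommGroup V] [Module F V]

theorem apply_mem_of_mem_subspaceStabilizer {U : Submodule F V} {g : V ≃ₗ[F] V}
    (hg : g ∈ subspaceStabilizer U) {x : V} (hx : x ∈ U) : g x ∈ U := by
  have h : U.map (g : V →ₗ[F] V) = U := hg
  rw [← h]
  exact Submodule.mem_map_of_mem hx

theorem mem_subspaceStabilizer_of_forall [FiniteDimensional F V] {U : Submodule F V}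
    {g : V ≃ₗ[F] V} (hg : ∀ x ∈ U, g x ∈ U) : g ∈ subspaceStabilizer U :=
  Submodule.eq_of_le_of_finrank_eq (Submodule.map_le_iff_le_comap.2 hg)
    (LinearEquiv.finrank_map_eq g U)

variable [Fintype ι] [DecidableEq ι] [CharP F 2] {β : LinearMap.BilinForm F V}
  {b : Module.Basis (ι ⊕ ι) F V}

/-- Every automorphism of the span of the `eᵢ` extends to an isometry stabilizing the span of
the `fᵢ`: let the latter space, which `β` identifies with the dual of the former, carry the
contragredient action. -/
theorem IsSymplecticBasis.exists_extension (hb : IsSymplecticBasis β b) (hβ : β.IsAlt)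
    (hβ' : β.Nondegenerate) (u : spanInl b ≃ₗ[F] spanInl b) :
    ∃ g ∈ bilinIsometryGroup β ⊓ subspaceStabilizer (spanInl b) ⊓ subspaceStabilizer (spanInr b),
      ∀ x : spanInl b, g (x : V) = (u x : V) := by
  have : FiniteDimensional F V := b.finiteDimensional_of_finite
  let w : ι → V := fun j => ∑ k, (basisInl b).repr (u.symm (basisInl b k)) j • b (Sum.inr k)
  have hw : ∀ j, w j ∈ spanInr b := fun j =>
    Submodule.sum_mem _ fun k _ => Submodule.smul_mem _ _ (inr_mem_spanInr b k)
  have hpair : ∀ (x : spanInl b) (j : ι), β x (w j) = (basisInl b).repr (u.symm x) j := by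
    intro x j
    have : (β.flip (w j)).comp (spanInl b).subtype =
        ((basisInl b).coord j).comp (u.symm : spanInl b →ₗ[F] spanInl b) := by
      refine (basisInl b).ext fun l => ?_
      simp [w, coe_basisInl, hb.inl_inr]
    exact LinearMap.congr_fun this x
  let φ : V →ₗ[F] V := b.constr F (Sum.elim (fun i => (u (basisInl b i) : V)) w)
  have hφl : ∀ i, φ (b (Sum.inl i)) = u (basisInl b i) := fun i => by simp [φ]
  have hφr : ∀ i, φ (b (Sum.inr i)) = w i := fun i => by simp [φ]
  have hlr : ∀ i j, β (φ (b (Sum.inl i))) (φ (b (Sum.inr j))) = if i = j then 1 else 0 := by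
    intro i j
    rw [hφl, hφr, hpair, LinearEquiv.symm_apply_apply, Module.Basis.repr_self,
      Finsupp.single_apply]
  obtain ⟨g, hgG, hg⟩ := exists_mem_bilinIsometryGroup hβ' φ
    (map_map_eq_of_basis (b := b) φ (by
      rintro (i | i) (j | j)
      · rw [hφl, hφl, hb.inl_inl]
        exact (hb.mem_spanInl_iff hβ).1 (u (basisInl b i)).2 _ (u (basisInl b j)).2
      · rw [hlr, hb.inl_inr]
      · rw [bilin_comm hβ, hlr, bilin_comm hβ, hb.inl_inr]
      · rw [hφr, hφr, hb.inr_inr, eq_sum_inl_add_sum_inr b (w j)]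
        simp [(mem_spanInr_iff_repr b).1 (hw _), hb.apply_inr]))
  have hU : ∀ x : spanInl b, g (x : V) = (u x : V) := by
    intro x
    have : φ.comp (spanInl b).subtype =
        (spanInl b).subtype.comp (u : spanInl b →ₗ[F] spanInl b) := by
      refine (basisInl b).ext fun l => ?_
      simp [coe_basisInl, hφl]
    rw [hg]
    exact LinearMap.congr_fun this x
  refine ⟨g, ⟨⟨hgG, mem_subspaceStabilizer_of_forall fun x hx => ?_⟩,
    mem_subspaceStabilizer_of_forall fun x hx => ?_⟩, hU⟩
  · rw [hU ⟨x, hx⟩]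
    exact (u _).2
  · rw [hg]
    have : spanInr b ≤ (spanInr b).comap φ := by
      refine Submodule.span_le.2 ?_
      rintro _ ⟨i, rfl⟩
      simpa [hφr] using hw i
    exact this hx

end Levi

/-! ### The unipotent radical -/

section Radical

variable {F V ι : Type*} [Field F] [AddCommGroup V] [Module F V]

/-- The isometries of `β` that fix every vector of `U`. For a totally isotropic subspace `U` equal
to its orthogonal space, this is the unipotent radical of the stabilizer of `U`. -/
def isometryFixator (β : LinearMap.BilinForm F V) (U : Submodule F V) : Subgroup (V ≃ₗ[F] V) where
  carrier := {g | g ∈ bilinIsometryGroup β ∧ ∀ x ∈ U, g x = x}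
  mul_mem' := fun {g h} hg hh => ⟨mul_mem hg.1 hh.1, fun x hx => by
    rw [LinearEquiv.mul_apply, hh.2 x hx, hg.2 x hx]⟩
  one_mem' := ⟨one_mem _, fun _ _ => rfl⟩
  inv_mem' := fun {g} hg => ⟨inv_mem hg.1, fun x hx => by
    conv_lhs => rw [← hg.2 x hx]
    exact g.symm_apply_apply x⟩

theorem isometryFixator_le (β : LinearMap.BilinForm F V) (U : Submodule F V) :
    isometryFixator β U ≤ bilinIsometryGroup β ⊓ subspaceStabilizer U := fun g hg =>
  ⟨hg.1, by
    refine le_antisymm (Submodule.map_le_iff_le_comap.2 fun x hx => ?_)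
      fun x hx => ⟨x, hx, hg.2 x hx⟩
    rw [Submodule.mem_comap, LinearEquiv.coe_coe, hg.2 x hx]
    exact hx⟩

theorem stabilizer_le_normalizer_isometryFixator (β : LinearMap.BilinForm F V)
    (U : Submodule F V) :
    bilinIsometryGroup β ⊓ subspaceStabilizer U ≤ Subgroup.normalizer (isometryFixator β U) := by
  refine Subgroup.le_normalizer_iff.2 fun a ha r hr => ⟨mul_mem (mul_mem ha.1 hr.1) (inv_mem ha.1),
    fun x hx => ?_⟩
  rw [LinearEquiv.mul_apply, LinearEquiv.mul_apply,
    hr.2 _ (apply_mem_of_mem_subspaceStabilizer (inv_mem ha.2) hx)]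
  exact a.apply_symm_apply x

/-- The linear group is transitive on the nonzero vectors. -/
theorem exists_linearEquiv_apply_eq [FiniteDimensional F V] {x y : V} (hx : x ≠ 0) (hy : y ≠ 0) :
    ∃ u : V ≃ₗ[F] V, u x = y := by
  obtain ⟨u, hu⟩ := Submodule.exists_linearEquiv_restrict_eq
    ((LinearEquiv.toSpanNonzeroSingleton F V x hx).symm ≪≫ₗ
      LinearEquiv.toSpanNonzeroSingleton F V y hy)
  refine ⟨u, ?_⟩
  have := hu ⟨x, Submodule.mem_span_singleton_self x⟩
  rw [← this]
  have h1 : (LinearEquiv.toSpanNonzeroSingleton F V x hx).symm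
      ⟨x, Submodule.mem_span_singleton_self x⟩ = 1 := by
    rw [LinearEquiv.symm_apply_eq, LinearEquiv.toSpanNonzeroSingleton_one]
  simp [h1]

variable [Fintype ι] [DecidableEq ι] [CharP F 2] {β : LinearMap.BilinForm F V}
  {b : Module.Basis (ι ⊕ ι) F V}

section

variable (hb : IsSymplecticBasis β b) (hβ : β.IsAlt)

include hb hβ

/-- As the span `U` of the `eᵢ` is its own orthogonal space, an isometry trivial on `U` is
trivial modulo `U`. -/
theorem IsSymplecticBasis.sub_mem_spanInl {g : V ≃ₗ[F] V}
    (hg : g ∈ isometryFixator β (spanInl b)) (x : V) : g x - x ∈ spanInl b := by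
  refine (hb.mem_spanInl_iff hβ).2 fun y hy => ?_
  rw [map_sub, LinearMap.sub_apply, sub_eq_zero]
  conv_lhs => rw [← hg.2 y hy]
  exact hg.1 x y

theorem IsSymplecticBasis.mul_apply_of_mem_isometryFixator {g h : V ≃ₗ[F] V}
    (hg : g ∈ isometryFixator β (spanInl b)) (hh : h ∈ isometryFixator β (spanInl b)) (x : V) :
    (g * h) x = (g x - x) + (h x - x) + x := by
  have := hg.2 _ (hb.sub_mem_spanInl hβ hh x)
  rw [map_sub, sub_eq_iff_eq_add] at this
  rw [LinearEquiv.mul_apply, this]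
  abel

theorem IsSymplecticBasis.mul_comm_of_mem_isometryFixator {g h : V ≃ₗ[F] V}
    (hg : g ∈ isometryFixator β (spanInl b)) (hh : h ∈ isometryFixator β (spanInl b)) :
    g * h = h * g := by
  ext x
  rw [hb.mul_apply_of_mem_isometryFixator hβ hg hh, hb.mul_apply_of_mem_isometryFixator hβ hh hg,
    add_comm (g x - x)]

theorem IsSymplecticBasis.sq_eq_one_of_mem_isometryFixator {g : V ≃ₗ[F] V}
    (hg : g ∈ isometryFixator β (spanInl b)) : g ^ 2 = 1 := by
  ext x
  rw [sq, hb.mul_apply_of_mem_isometryFixator hβ hg hg, ← two_smul F (g x - x),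
    CharTwo.two_eq_zero, zero_smul, zero_add, LinearEquiv.coe_one, id]

variable [Finite F] (hβ' : β.Nondegenerate)

include hβ'

/-- A normal `2`-subgroup of the stabilizer of `U`, the span of the `eᵢ`, acts trivially on `U`:
it fixes a nonzero vector of `U`, and the stabilizer permutes the nonzero vectors of `U`
transitively. -/
theorem IsSymplecticBasis.le_isometryFixator {M : Subgroup (V ≃ₗ[F] V)}
    (hM : M ≤ bilinIsometryGroup β ⊓ subspaceStabilizer (spanInl b))
    (hn : bilinIsometryGroup β ⊓ subspaceStabilizer (spanInl b) ≤ Subgroup.normalizer M)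
    (hp : IsPGroup 2 M) : M ≤ isometryFixator β (spanInl b) := by
  have hfd : FiniteDimensional F V := b.finiteDimensional_of_finite
  have : Finite V := Module.finite_of_finite F
  let _ : MulAction M (spanInl b) :=
    { smul := fun g x => ⟨(g : V ≃ₗ[F] V) x, apply_mem_of_mem_subspaceStabilizer (hM g.2).2 x.2⟩
      one_smul := fun _ => rfl
      mul_smul := fun _ _ _ => rfl }
  have hsmul : ∀ (g : M) (x : spanInl b), ((g • x : spanInl b) : V) = (g : V ≃ₗ[F] V) x :=
    fun _ _ => rfl
  refine fun g hg => ⟨(hM hg).1, fun y hy => ?_⟩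
  by_cases hy0 : y = 0
  · rw [hy0, map_zero]
  have hnt : Nontrivial (spanInl b) := ⟨⟨⟨y, hy⟩, 0, fun h => hy0 (congrArg Subtype.val h)⟩⟩
  have hdvd : 2 ∣ Nat.card (spanInl b) := by
    rw [Module.natCard_eq_pow_finrank (K := F)]
    refine dvd_pow ?_ Module.finrank_pos.ne'
    rw [← CharP.cast_eq_zero_iff F 2]
    have := Fintype.ofFinite F
    simp
  obtain ⟨x, hx, hx0⟩ := hp.exists_fixed_point_of_prime_dvd_card_of_fixed_point (spanInl b) hdvd
    (a := 0) (fun g => Subtype.ext (by rw [hsmul]; exact map_zero _))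
  obtain ⟨u, hu⟩ := exists_linearEquiv_apply_eq (F := F) hx0.symm
    (y := (⟨y, hy⟩ : spanInl b)) (fun h => hy0 (congrArg Subtype.val h))
  obtain ⟨a, ha, hau⟩ := hb.exists_extension hβ hβ' u
  have hax : a x = y := by rw [hau, hu]
  have hconj : a⁻¹ * g * a ∈ M := by
    have := Subgroup.le_normalizer_iff.1 hn a⁻¹ (inv_mem ha.1) g hg
    rwa [inv_inv] at this
  have hfix := congrArg Subtype.val (hx ⟨_, hconj⟩)
  rw [hsmul] at hfix
  have hfix' : a.symm (g (a x)) = x := hfix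
  rwa [LinearEquiv.symm_apply_eq, hax] at hfix'

theorem IsSymplecticBasis.pCore_two :
    pCore 2 (bilinIsometryGroup β ⊓ subspaceStabilizer (spanInl b)) =
      isometryFixator β (spanInl b) := by
  refine le_antisymm (sSup_le ?_) (le_sSup ⟨isometryFixator_le β _, ?_, fun g => ⟨1, ?_⟩⟩)
  · rintro M ⟨hM, hn, hp⟩
    exact hb.le_isometryFixator hβ hβ' hM
      ((Subgroup.normal_subgroupOf_iff_le_normalizer hM).1 hn) hp
  · exact (Subgroup.normal_subgroupOf_iff_le_normalizer (isometryFixator_le β _)).2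
      (stabilizer_le_normalizer_isometryFixator β _)
  · exact Subtype.ext (by simpa using hb.sq_eq_one_of_mem_isometryFixator hβ g.2)

end

/-- An isometry `g` that is trivial on the span of the `eᵢ` is determined by the matrix of the
values `β (g fᵢ) fⱼ`, which can be any symmetric matrix. -/
theorem IsSymplecticBasis.exists_equiv_symmetric (hb : IsSymplecticBasis β b) (hβ : β.IsAlt)
    (hβ' : β.Nondegenerate) :
    Nonempty (isometryFixator β (spanInl b) ≃ {s : ι → ι → F // ∀ i j, s i j = s j i}) := by
  have hfd : FiniteDimensional F V := b.finiteDimensional_of_finite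
  let f : isometryFixator β (spanInl b) → {s : ι → ι → F // ∀ i j, s i j = s j i} := fun g =>
    ⟨fun i j => β (g.1 (b (Sum.inr i))) (b (Sum.inr j)), fun i j => by
      have h1 := (hb.mem_spanInl_iff hβ).1 (hb.sub_mem_spanInl hβ g.2 (b (Sum.inr i)))
        _ (hb.sub_mem_spanInl hβ g.2 (b (Sum.inr j)))
      have h2 := g.2.1 (b (Sum.inr i)) (b (Sum.inr j))
      have h3 := hb.inr_inr i j
      simp only [map_sub, LinearMap.sub_apply, h2, h3] at h1
      change β (g.1 (b (Sum.inr i))) (b (Sum.inr j)) = β (g.1 (b (Sum.inr j))) (b (Sum.inr i))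
      rw [bilin_comm hβ (g.1 (b (Sum.inr j))), ← CharTwo.add_eq_zero]
      rw [CharTwo.sub_eq_add, CharTwo.sub_eq_add] at h1
      linear_combination h1⟩
  refine ⟨Equiv.ofBijective f ⟨fun g h hgh => ?_, fun s => ?_⟩⟩
  · refine Subtype.ext (LinearEquiv.toLinearMap_injective (b.ext ?_))
    rintro (i | i)
    · exact (g.2.2 _ (inl_mem_spanInl b i)).trans (h.2.2 _ (inl_mem_spanInl b i)).symm
    · have hmem : g.1 (b (Sum.inr i)) - h.1 (b (Sum.inr i)) ∈ spanInl b := by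
        have := sub_mem (hb.sub_mem_spanInl hβ g.2 (b (Sum.inr i)))
          (hb.sub_mem_spanInl hβ h.2 (b (Sum.inr i)))
        simpa using this
      have hz : g.1 (b (Sum.inr i)) - h.1 (b (Sum.inr i)) = 0 := by
        rw [← b.repr.map_eq_zero_iff]
        ext (j | j)
        · rw [← hb.apply_inr, map_sub, LinearMap.sub_apply]
          exact sub_eq_zero.2 <| congrFun (congrFun (congrArg Subtype.val hgh) i) j
        · exact (mem_spanInl_iff_repr b).1 hmem j
      exact sub_eq_zero.1 hz
  · let w : ι → V := fun i => ∑ k, s.1 i k • b (Sum.inl k)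
    have hw : ∀ i, w i ∈ spanInl b := fun i =>
      Submodule.sum_mem _ fun k _ => Submodule.smul_mem _ _ (inl_mem_spanInl b k)
    have hwr : ∀ i j, β (w i) (b (Sum.inr j)) = s.1 i j := fun i j => by
      simp [w, hb.inl_inr]
    let φ : V →ₗ[F] V :=
      b.constr F (Sum.elim (fun i => b (Sum.inl i)) fun i => b (Sum.inr i) + w i)
    have hφl : ∀ i, φ (b (Sum.inl i)) = b (Sum.inl i) := fun i => by simp [φ]
    have hφr : ∀ i, φ (b (Sum.inr i)) = b (Sum.inr i) + w i := fun i => by simp [φ]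
    have hlw : ∀ i j, β (b (Sum.inl i)) (w j) = 0 := fun i j =>
      (hb.mem_spanInl_iff hβ).1 (inl_mem_spanInl b i) _ (hw j)
    obtain ⟨g, hgG, hg⟩ := exists_mem_bilinIsometryGroup hβ' φ
      (map_map_eq_of_basis (b := b) φ (by
        rintro (i | i) (j | j)
        · rw [hφl, hφl]
        · rw [hφl, hφr, map_add, hlw, add_zero]
        · rw [hφl, hφr, bilin_comm hβ, map_add, hlw, add_zero, bilin_comm hβ]
        · rw [hφr, hφr, map_add, map_add, LinearMap.add_apply, LinearMap.add_apply, hwr,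
            bilin_comm hβ _ (w j), hwr, s.2 j i, (hb.mem_spanInl_iff hβ).1 (hw i) _ (hw j),
            add_zero, add_assoc, CharTwo.add_self_eq_zero, add_zero]))
    refine ⟨⟨g, hgG, fun x hx => ?_⟩, Subtype.ext ?_⟩
    · have : spanInl b ≤ LinearMap.eqLocus φ LinearMap.id := by
        refine Submodule.span_le.2 ?_
        rintro _ ⟨i, rfl⟩
        exact hφl i
      rw [hg]
      exact this hx
    · funext i j
      change β (g (b (Sum.inr i))) (b (Sum.inr j)) = s.1 i j
      rw [hg, hφr, map_add, LinearMap.add_apply, hb.inr_inr, hwr, zero_add]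

theorem IsSymplecticBasis.card_isometryFixator (hb : IsSymplecticBasis β b) (hβ : β.IsAlt)
    (hβ' : β.Nondegenerate) :
    Nat.card (isometryFixator β (spanInl b)) =
      Nat.card F ^ (Fintype.card ι * (Fintype.card ι + 1) / 2) := by
  obtain ⟨E⟩ := hb.exists_equiv_symmetric hβ hβ'
  rw [Nat.card_congr (E.trans Sym2.lift), Nat.card_fun, Nat.card_eq_fintype_card (α := Sym2 ι),
    Sym2.card,
    Nat.choose_two_right, Nat.add_sub_cancel, mul_comm (Fintype.card ι + 1)]

end Radical

/-! ### Split extensions -/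

section SplitExtension

variable {X : Type*} [Group X] {A N C S : Subgroup X}

theorem IsSplitExtension.le_normalizer (h : IsSplitExtension A N C) :
    A ≤ Subgroup.normalizer N :=
  (Subgroup.normal_subgroupOf_iff_le_normalizer h.1).1 h.2.2.1

theorem IsSplitExtension.sup_of_le (h : IsSplitExtension A N C) (hS : S ≤ C) :
    IsSplitExtension (N ⊔ S) N S := by
  have hn : S ≤ Subgroup.normalizer N := (hS.trans h.2.1).trans h.le_normalizer
  refine ⟨le_sup_left, le_sup_right, ?_, ?_, Subgroup.coe_mul_of_right_le_normalizer_left N S hn⟩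
  · exact (Subgroup.normal_subgroupOf_iff_le_normalizer le_sup_left).2
      (sup_le Subgroup.le_normalizer hn)
  · exact le_bot_iff.1 ((inf_le_inf_left N hS).trans h.2.2.2.1.le)

theorem IsSplitExtension.isSolvable (h : IsSplitExtension A N C) (hN : Group.IsSolvable N)
    (hC : Group.IsSolvable C) : Group.IsSolvable A := by
  have := h.2.2.1
  have hsurj : Function.Surjective
      ((QuotientGroup.mk' (N.subgroupOf A)).comp (Subgroup.inclusion h.2.1)) := by
    intro y
    obtain ⟨⟨a, ha⟩, rfl⟩ := QuotientGroup.mk'_surjective _ y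
    obtain ⟨n, hn, c, hc, rfl⟩ : a ∈ (N : Set X) * (C : Set X) := by rw [← h.2.2.2.2]; exact ha
    refine ⟨⟨c, hc⟩, ?_⟩
    rw [MonoidHom.comp_apply, QuotientGroup.mk'_apply, QuotientGroup.mk'_apply, eq_comm,
      ← inv_inj, ← QuotientGroup.mk_inv, ← QuotientGroup.mk_inv, QuotientGroup.eq,
      Subgroup.mem_subgroupOf]
    simpa using hn
  have hq : Group.IsSolvable (A ⧸ N.subgroupOf A) := Group.isSolvable_of_surjective hsurj
  refine Group.isSolvable_of_ker_le_range (Subgroup.inclusion h.1)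
    (QuotientGroup.mk' (N.subgroupOf A)) ?_
  rw [QuotientGroup.ker_mk', Subgroup.inclusion_range]

end SplitExtension

/-! ### Complements of the unipotent radical -/

section Complement

variable {F V ι : Type*} [Field F] [AddCommGroup V] [Module F V] [Fintype ι] [DecidableEq ι]
  [CharP F 2] {β : LinearMap.BilinForm F V} {b : Module.Basis (ι ⊕ ι) F V}
  (hb : IsSymplecticBasis β b) (hβ : β.IsAlt) (hβ' : β.Nondegenerate)

include hb hβ hβ'

theorem IsSymplecticBasis.isSplitExtension :
    IsSplitExtension (bilinIsometryGroup β ⊓ subspaceStabilizer (spanInl b))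
      (isometryFixator β (spanInl b))
      (bilinIsometryGroup β ⊓ subspaceStabilizer (spanInl b) ⊓ subspaceStabilizer (spanInr b)) := by
  refine ⟨isometryFixator_le β _, inf_le_left,
    (Subgroup.normal_subgroupOf_iff_le_normalizer (isometryFixator_le β _)).2
      (stabilizer_le_normalizer_isometryFixator β _),
    (Subgroup.eq_bot_iff_forall _).2 fun g hg => ?_, Set.Subset.antisymm (fun a ha => ?_) ?_⟩
  · refine LinearEquiv.toLinearMap_injective (b.ext ?_)
    rintro (i | i)
    · exact hg.1.2 _ (inl_mem_spanInl b i)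
    · have h1 := hb.sub_mem_spanInl hβ hg.1 (b (Sum.inr i))
      have h2 := sub_mem (apply_mem_of_mem_subspaceStabilizer hg.2.2 (inr_mem_spanInr b i))
        (inr_mem_spanInr b i)
      have hz : g (b (Sum.inr i)) - b (Sum.inr i) = 0 := by
        rw [← b.repr.map_eq_zero_iff]
        ext (j | j)
        · exact (mem_spanInr_iff_repr b).1 h2 j
        · exact (mem_spanInl_iff_repr b).1 h1 j
      exact sub_eq_zero.1 hz
  · obtain ⟨l, hl, hlu⟩ := hb.exists_extension hβ hβ'
      (LinearEquiv.ofSubmodules a (spanInl b) (spanInl b) ha.2)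
    refine ⟨a * l⁻¹, ⟨mul_mem ha.1 (inv_mem hl.1.1), fun x hx => ?_⟩, l, hl, by group⟩
    have hx' : l.symm x ∈ spanInl b :=
      apply_mem_of_mem_subspaceStabilizer (inv_mem hl.1.2) hx
    have := hlu ⟨l.symm x, hx'⟩
    have : l (l.symm x) = a (l.symm x) := this
    exact this.symm.trans (l.apply_symm_apply x)
  · rintro _ ⟨n, hn, l, hl, rfl⟩
    exact mul_mem (isometryFixator_le β _ hn) hl.1

/-- Restriction to the span of the `eᵢ` identifies every complement of the unipotent radical with
the general linear group. -/
theorem IsSymplecticBasis.existsUnique_mem_complement {C : Subgroup (V ≃ₗ[F] V)}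
    (hC : IsSplitExtension (bilinIsometryGroup β ⊓ subspaceStabilizer (spanInl b))
      (isometryFixator β (spanInl b)) C) (u : spanInl b ≃ₗ[F] spanInl b) :
    ∃! g : V ≃ₗ[F] V, g ∈ C ∧ ∀ x : spanInl b, g (x : V) = (u x : V) := by
  obtain ⟨l, hl, hlu⟩ := hb.exists_extension hβ hβ' u
  obtain ⟨n, hn, c, hc, hnc⟩ :
      l ∈ (isometryFixator β (spanInl b) : Set (V ≃ₗ[F] V)) * (C : Set (V ≃ₗ[F] V)) := by
    rw [← hC.2.2.2.2]
    exact hl.1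
  have hcu : ∀ x : spanInl b, c (x : V) = (u x : V) := fun x => by
    rw [← hlu, ← hnc]
    exact (hn.2 _ (apply_mem_of_mem_subspaceStabilizer (hC.2.1 hc).2 x.2)).symm
  refine ⟨c, ⟨hc, hcu⟩, fun g hg => ?_⟩
  have hmem : c⁻¹ * g ∈ isometryFixator β (spanInl b) ⊓ C := by
    refine ⟨⟨mul_mem (inv_mem (hC.2.1 hc).1) (hC.2.1 hg.1).1, fun x hx => ?_⟩,
      C.mul_mem (C.inv_mem hc) hg.1⟩
    change c.symm (g x) = x
    rw [LinearEquiv.symm_apply_eq, hg.2 ⟨x, hx⟩, ← hcu ⟨x, hx⟩]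
  rw [hC.2.2.2.1, Subgroup.mem_bot, inv_mul_eq_one] at hmem
  exact hmem.symm

end Complement

/-! ### Singer cycles -/

section Singer

variable {F : Type*} [Field F]

/-- A Singer cycle exists on every nonzero finite-dimensional space over a finite field, since the
field has an extension of the corresponding degree. -/
theorem exists_isSingerCycle [Finite F] {U : Type v} [AddCommGroup U] [Module F U]
    [FiniteDimensional F U] [Nontrivial U] : ∃ T : Subgroup (U ≃ₗ[F] U), IsSingerCycle T := by
  obtain ⟨p, _⟩ := CharP.exists F
  have : Fact p.Prime := ⟨CharP.char_is_prime F p⟩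
  have : NeZero (Module.finrank F U) := ⟨Module.finrank_pos.ne'⟩
  let L := ULift.{v} (FiniteField.Extension F p (Module.finrank F U))
  have hfin : Module.finrank F L = Module.finrank F U := by
    rw [LinearEquiv.finrank_eq (ULift.moduleEquiv (R := F)), FiniteField.finrank_extension]
  have : FiniteDimensional F L := Module.finite_of_finrank_pos <| by
    rw [hfin]; exact Module.finrank_pos
  let ψ : L ≃ₗ[F] U := LinearEquiv.ofFinrankEq L U hfin
  refine ⟨{ carrier := {g | ∃ a : L, a ≠ 0 ∧ ∀ x : L, g (ψ x) = ψ (a * x)}, mul_mem' := ?_,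
            one_mem' := ?_, inv_mem' := ?_ }, L, inferInstance, inferInstance, ψ, fun g => Iff.rfl⟩
  · rintro g h ⟨a, ha, hg⟩ ⟨c, hc, hh⟩
    exact ⟨a * c, mul_ne_zero ha hc, fun x => by rw [LinearEquiv.mul_apply, hh, hg, mul_assoc]⟩
  · exact ⟨1, one_ne_zero, fun x => by rw [one_mul, LinearEquiv.coe_one, id]⟩
  · rintro g ⟨a, ha, hg⟩
    refine ⟨a⁻¹, inv_ne_zero ha, fun x => ?_⟩
    change g.symm (ψ x) = _
    rw [LinearEquiv.symm_apply_eq, hg, mul_inv_cancel_left₀ ha]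

variable {V : Type v} [AddCommGroup V] [Module F V] {U : Submodule F V}
  {C S : Subgroup (V ≃ₗ[F] V)}

variable (U C) in
theorem exists_isSingerCycleVia [Finite F] [FiniteDimensional F U] [Nontrivial U] :
    ∃ S : Subgroup (V ≃ₗ[F] V), IsSingerCycleVia U C S := by
  obtain ⟨T, hT⟩ := exists_isSingerCycle (F := F) (U := U)
  refine ⟨{ carrier := {g | g ∈ C ∧ ∃ t ∈ T, ∀ x : U, g (x : V) = (t x : V)}, mul_mem' := ?_,
            one_mem' := ?_, inv_mem' := ?_ }, fun g hg => hg.1, T, hT,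
            fun g hg => ⟨fun h => h.2, fun h => ⟨hg, h⟩⟩⟩
  · rintro g h ⟨hg, s, hs, hgs⟩ ⟨hh, t, ht, hht⟩
    exact ⟨mul_mem hg hh, s * t, mul_mem hs ht, fun x => by
      rw [LinearEquiv.mul_apply, hht, hgs, LinearEquiv.mul_apply]⟩
  · exact ⟨one_mem C, 1, one_mem T, fun x => rfl⟩
  · rintro g ⟨hg, s, hs, hgs⟩
    refine ⟨inv_mem hg, s⁻¹, inv_mem hs, fun x => ?_⟩
    change g.symm x = (s.symm x : V)
    rw [LinearEquiv.symm_apply_eq, hgs, LinearEquiv.apply_symm_apply]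

/-- If restriction to `U` identifies `C` with the general linear group of `U`, then a Singer cycle
of `C` acts on `U`, identified with a field extension `L`, as the multiplicative group of `L`. -/
theorem IsSingerCycleVia.exists_field
    (hC : ∀ u : U ≃ₗ[F] U, ∃! g : V ≃ₗ[F] V, g ∈ C ∧ ∀ x : U, g (x : V) = (u x : V))
    (hS : IsSingerCycleVia U C S) :
    ∃ (L : Type v) (_ : Field L) (_ : Algebra F L) (ψ : L ≃ₗ[F] U),
      (∀ a : L, a ≠ 0 → ∃ s ∈ S, ∀ x : L, s (ψ x : V) = (ψ (a * x) : V)) ∧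
      Nonempty (S ≃* Lˣ) := by
  obtain ⟨hSC, T, ⟨L, iL, iA, ψ, hT⟩, hST⟩ := hS
  have hex : ∀ a : Lˣ, ∃ s : S, ∀ x : L, s.1 (ψ x : V) = (ψ (a * x) : V) := fun a => by
    let u : U ≃ₗ[F] U := ψ.symm ≪≫ₗ DistribMulAction.toLinearEquiv F L a ≪≫ₗ ψ
    have hu : ∀ x, u (ψ x) = ψ (a * x) := fun x => by
      simp [u, Units.smul_def]
    obtain ⟨g, ⟨hgC, hgu⟩, -⟩ := hC u
    exact ⟨⟨g, (hST g hgC).2 ⟨u, (hT u).2 ⟨a, a.ne_zero, hu⟩, hgu⟩⟩, fun x => by rw [hgu, hu]⟩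
  have hinj : ∀ s t : S, (∀ x : L, s.1 (ψ x : V) = t.1 (ψ x : V)) → s = t := fun s t hst => by
    obtain ⟨v, -, hv⟩ := (hST _ (hSC s.2)).1 s.2
    refine Subtype.ext ((hC v).unique ⟨hSC s.2, hv⟩ ⟨hSC t.2, fun x => ?_⟩)
    rw [← hv, ← ψ.apply_symm_apply x, hst]
  choose f hf using hex
  refine ⟨L, iL, iA, ψ, fun a ha => ⟨f (Units.mk0 a ha), (f _).2, hf (Units.mk0 a ha)⟩, ?_⟩
  let θ : Lˣ →* S := MonoidHom.mk' f fun a c => hinj _ _ fun x => by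
    rw [hf, Subgroup.coe_mul, LinearEquiv.mul_apply, hf, hf, Units.val_mul, mul_assoc]
  refine ⟨(MulEquiv.ofBijective θ ⟨fun a c hac => ?_, fun s => ?_⟩).symm⟩
  · have h := hf a 1
    have h' : f a = f c := hac
    rw [h', hf, mul_one, mul_one] at h
    exact (Units.ext (ψ.injective (Subtype.ext h))).symm
  · obtain ⟨t, ht, hst⟩ := (hST _ (hSC s.2)).1 s.2
    obtain ⟨a, ha, hta⟩ := (hT t).1 ht
    refine ⟨Units.mk0 a ha, hinj _ _ fun x => ?_⟩
    change (f (Units.mk0 a ha)).1 (ψ x : V) = _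
    rw [hf, hst, hta, Units.val_mk0]

theorem nonempty_mulEquiv_generalLinearGroup_one [Finite F] {L : Type*} [Field L] [Algebra F L]
    [FiniteDimensional F L] {L' : Type*} [Field L']
    (h : Nat.card L' = Nat.card F ^ Module.finrank F L) :
    Nonempty (Lˣ ≃* Matrix.GeneralLinearGroup (Fin 1) L') := by
  have : Finite L := Module.finite_of_finite F
  have hL : Nat.card L = Nat.card L' := by rw [h, Module.natCard_eq_pow_finrank (K := F)]
  have : Finite L' := Nat.finite_of_card_ne_zero (hL ▸ Nat.card_pos.ne')
  have := Fintype.ofFinite L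
  have := Fintype.ofFinite L'
  rw [Nat.card_eq_fintype_card, Nat.card_eq_fintype_card] at hL
  let E : L ≃+* Matrix (Fin 1) (Fin 1) L' :=
    (FiniteField.ringEquivOfCardEq hL).trans Matrix.uniqueRingEquiv.symm
  exact ⟨Units.mapEquiv E.toMulEquiv⟩

/-- The multiplicative group of an extension field `L` is transitive on the nonzero linear forms
on `L`: these form a one-dimensional space over `L`. -/
theorem exists_mul_eq_of_linearForm {L : Type*} [Field L] [Algebra F L] [FiniteDimensional F L]
    {μ ν : L →ₗ[F] F} (hμ : μ ≠ 0) (hν : ν ≠ 0) : ∃ a : L, a ≠ 0 ∧ ∀ x, μ (a * x) = ν x := by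
  let Φ : L →ₗ[F] Module.Dual F L := (LinearMap.mul F L).compr₂ μ
  have hΦ : ∀ a x, Φ a x = μ (a * x) := fun _ _ => rfl
  have hinj : Function.Injective Φ := by
    rw [injective_iff_map_eq_zero]
    intro a ha
    by_contra ha0
    refine hμ (LinearMap.ext fun x => ?_)
    have := hΦ a (a⁻¹ * x)
    rw [ha, mul_inv_cancel_left₀ ha0] at this
    exact this.symm
  obtain ⟨a, ha⟩ := (LinearMap.injective_iff_surjective_of_finrank_eq_finrank
    (Subspace.dual_finrank_eq (K := F) (V := L)).symm).1 hinj ν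
  refine ⟨a, ?_, fun x => by rw [← hΦ, ha]⟩
  rintro rfl
  exact hν (by rw [← ha, map_zero])

end Singer

/-! ### Quadratic forms of minus type -/

section MinusType

variable {F V ι : Type*} [Field F] [AddCommGroup V] [Module F V]

/-- The quadratic form `Q` has polar form `β` and vanishes on the basis `b`, except that
`Q eₖ = 1` and `Q fₖ = σ`, where `σ` is not of the form `t + t ^ 2`. In characteristic two, for a
symplectic basis `b`, the plane `⟨eₖ, fₖ⟩` is then anisotropic. -/
structure IsMinusForm [DecidableEq ι] (Q : QuadraticForm F V) (β : LinearMap.BilinForm F V)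
    (b : Module.Basis (ι ⊕ ι) F V) (k : ι) (σ : F) : Prop where
  polar : ∀ x y, QuadraticMap.polar Q x y = β x y
  inl : ∀ i, Q (b (Sum.inl i)) = if i = k then 1 else 0
  inr : ∀ i, Q (b (Sum.inr i)) = if i = k then σ else 0
  add_sq_ne : ∀ t : F, t + t ^ 2 ≠ σ

theorem quadraticForm_add {Q : QuadraticForm F V} {β : LinearMap.BilinForm F V}
    (hQ : ∀ x y, QuadraticMap.polar Q x y = β x y) (x y : V) :
    Q (x + y) = Q x + Q y + β x y := by
  rw [← hQ, QuadraticMap.polar]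
  ring

theorem polar_comp_of_mem_bilinIsometryGroup {Q : QuadraticForm F V} {β : LinearMap.BilinForm F V}
    (hQ : ∀ x y, QuadraticMap.polar Q x y = β x y) {g : V ≃ₗ[F] V}
    (hg : g ∈ bilinIsometryGroup β) (x y : V) :
    QuadraticMap.polar (Q.comp (g : V →ₗ[F] V)) x y = β x y := by
  have h : QuadraticMap.polar (Q.comp (g : V →ₗ[F] V)) x y = QuadraticMap.polar Q (g x) (g y) := by
    simp [QuadraticMap.polar]
  rw [h, hQ]
  exact hg x y

theorem quadIsometryGroup_le {Q : QuadraticForm F V} {β : LinearMap.BilinForm F V}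
    (hQ : ∀ x y, QuadraticMap.polar Q x y = β x y) :
    quadIsometryGroup Q ≤ bilinIsometryGroup β := by
  intro g hg x y
  have hg' : ∀ x, Q (g x) = Q x := hg
  rw [← hQ, ← hQ, QuadraticMap.polar, QuadraticMap.polar, ← map_add, hg', hg', hg']

/-- The span of the `eᵢ` with `i ≠ k`. -/
def spanInlNe (b : Module.Basis (ι ⊕ ι) F V) (k : ι) : Submodule F V :=
  Submodule.span F (Set.range fun i : {i // i ≠ k} => b (Sum.inl i))

variable [Fintype ι] [DecidableEq ι]

theorem finrank_spanInlNe (b : Module.Basis (ι ⊕ ι) F V) (k : ι) :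
    Module.finrank F (spanInlNe b k) = Fintype.card ι - 1 := by
  have h : LinearIndependent F fun i : {i // i ≠ k} => b (Sum.inl i) :=
    b.linearIndependent.comp _ (Sum.inl_injective.comp Subtype.val_injective)
  rw [spanInlNe, finrank_span_eq_card h, Fintype.card_subtype_compl, Fintype.card_subtype_eq]

theorem mem_spanInlNe_iff {b : Module.Basis (ι ⊕ ι) F V} {k : ι} {x : V} :
    x ∈ spanInlNe b k ↔ x ∈ spanInl b ∧ b.repr x (Sum.inl k) = 0 := by
  refine ⟨fun hx => ?_, fun ⟨h, hk⟩ => ?_⟩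
  · have : spanInlNe b k ≤ spanInl b ⊓ LinearMap.ker (b.coord (Sum.inl k)) := by
      refine Submodule.span_le.2 ?_
      rintro _ ⟨i, rfl⟩
      exact ⟨inl_mem_spanInl b i, by simp [i.2]⟩
    exact this hx
  · rw [eq_sum_inl_add_sum_inr b x]
    simp only [(mem_spanInl_iff_repr b).1 h, zero_smul, Finset.sum_const_zero, add_zero]
    refine Submodule.sum_mem _ fun i _ => ?_
    by_cases hi : i = k
    · rw [hi, hk, zero_smul]
      exact zero_mem _
    · exact Submodule.smul_mem _ _ (Submodule.subset_span ⟨⟨i, hi⟩, rfl⟩)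

omit [DecidableEq ι] in
theorem finrank_eq_two_mul_card (b : Module.Basis (ι ⊕ ι) F V) :
    Module.finrank F V = 2 * Fintype.card ι := by
  rw [Module.finrank_eq_card_basis b, Fintype.card_sum, two_mul]

variable [Finite F] [CharP F 2] {β : LinearMap.BilinForm F V} {b : Module.Basis (ι ⊕ ι) F V}

/-- On a totally isotropic subspace, a quadratic form is the square of a linear form. -/
theorem exists_linearMap_sq_of_isotropic {Q : QuadraticForm F V} {U : Submodule F V}
    (hQ : ∀ x y, QuadraticMap.polar Q x y = β x y) (hU : ∀ x ∈ U, ∀ y ∈ U, β x y = 0) :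
    ∃ μ : U →ₗ[F] F, ∀ x : U, Q x = μ x ^ 2 := by
  refine exists_linearMap_sq (fun x : U => Q x) (fun x y => ?_) fun c x => ?_
  · rw [Submodule.coe_add, quadraticForm_add hQ, hU x x.2 y y.2, add_zero]
  · rw [Submodule.coe_smul, QuadraticMap.map_smul, smul_eq_mul, sq]

section

variable {Q : QuadraticForm F V} {k : ι} {σ : F}
  (hb : IsSymplecticBasis β b) (hβ : β.IsAlt) (hQ : IsMinusForm Q β b k σ)

include hb hβ hQ

theorem IsMinusForm.apply_of_mem_spanInl {x : V} (hx : x ∈ spanInl b) :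
    Q x = b.repr x (Sum.inl k) ^ 2 := by
  obtain ⟨μ, hμ⟩ := exists_linearMap_sq_of_isotropic hQ.polar
    (fun x hx y hy => (hb.mem_spanInl_iff hβ).1 hx y hy)
  have : μ = (b.coord (Sum.inl k)).comp (spanInl b).subtype := by
    refine (basisInl b).ext fun i => ?_
    rw [← CharTwo.sq_inj, ← hμ, coe_basisInl, hQ.inl]
    by_cases hi : i = k <;> simp [coe_basisInl, hi]
  rw [hμ ⟨x, hx⟩, this]
  rfl

theorem IsMinusForm.apply_eq_zero_of_mem_spanInlNe {x : V} (hx : x ∈ spanInlNe b k) : Q x = 0 := by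
  obtain ⟨h, hk⟩ := mem_spanInlNe_iff.1 hx
  rw [hQ.apply_of_mem_spanInl hb hβ h, hk, sq, zero_mul]

theorem IsMinusForm.mem_spanInlNe_of_apply_eq_zero {x : V} (hx : Q x = 0)
    (hort : ∀ i, i ≠ k → β (b (Sum.inl i)) x = 0) : x ∈ spanInlNe b k := by
  have hr : ∀ i, i ≠ k → b.repr x (Sum.inr i) = 0 := fun i hi => by
    rw [← hb.inl_apply hβ, hort i hi]
  have hy : x - b.repr x (Sum.inr k) • b (Sum.inr k) ∈ spanInl b := by
    refine (mem_spanInl_iff_repr b).2 fun j => ?_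
    by_cases hj : j = k
    · simp [hj]
    · simp [hr j hj, hj]
  have hval := quadraticForm_add hQ.polar (x - b.repr x (Sum.inr k) • b (Sum.inr k))
    (b.repr x (Sum.inr k) • b (Sum.inr k))
  rw [sub_add_cancel, hx, hQ.apply_of_mem_spanInl hb hβ hy, QuadraticMap.map_smul, hQ.inr,
    map_smul, hb.apply_inr] at hval
  simp only [map_sub, map_smul, Finsupp.sub_apply, Finsupp.smul_apply, Module.Basis.repr_self,
    smul_eq_mul, if_true, Finsupp.single_apply, reduceCtorEq, if_false, mul_zero, sub_zero] at hval
  obtain ⟨h1, h2⟩ := eq_zero_of_sq_add_mul_add hQ.add_sq_ne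
    (x := b.repr x (Sum.inl k)) (y := b.repr x (Sum.inr k)) (by linear_combination -hval)
  rw [h2, zero_smul, sub_zero] at hy
  exact mem_spanInlNe_iff.2 ⟨hy, h1⟩

variable (hβ' : β.Nondegenerate)

include hβ'

/-- Let `E = ⟨eᵢ : i ≠ k⟩` and let `W` be totally singular. As `⟨eₖ, fₖ⟩` is anisotropic,
`W ∩ Eᗮ = W ∩ E`; this space is orthogonal to both `W` and `Eᗮ`, and the bound follows by
counting dimensions. -/
theorem IsMinusForm.finrank_lt_of_singular {W : Submodule F V} (hW : ∀ x ∈ W, Q x = 0) :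
    Module.finrank F W < Fintype.card ι := by
  have hfd : FiniteDimensional F V := b.finiteDimensional_of_finite
  have hWE : W ⊓ β.orthogonal (spanInlNe b k) ≤ W ⊓ spanInlNe b k := fun x hx =>
    ⟨hx.1, hQ.mem_spanInlNe_of_apply_eq_zero hb hβ (hW x hx.1) fun i hi =>
      hx.2 _ (Submodule.subset_span ⟨⟨i, hi⟩, rfl⟩)⟩
  have hsup : W ⊔ β.orthogonal (spanInlNe b k) ≤ β.orthogonal (W ⊓ spanInlNe b k) := by
    refine sup_le (fun x hx y hy => ?_) (LinearMap.BilinForm.orthogonal_le inf_le_right)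
    have := quadraticForm_add hQ.polar y x
    rw [hW _ (add_mem hy.1 hx), hW _ hy.1, hW _ hx, zero_add, zero_add] at this
    exact this.symm
  have h1 := Submodule.finrank_mono hWE
  have h2 := Submodule.finrank_mono hsup
  have h3 := Submodule.finrank_sup_add_finrank_inf_eq W (β.orthogonal (spanInlNe b k))
  have h4 := Submodule.finrank_le (W ⊓ spanInlNe b k)
  have hpos : 0 < Fintype.card ι := Fintype.card_pos_iff.2 ⟨k⟩
  rw [LinearMap.BilinForm.finrank_orthogonal hβ', finrank_eq_two_mul_card b] at h2
  rw [LinearMap.BilinForm.finrank_orthogonal hβ', finrank_eq_two_mul_card b,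
    finrank_spanInlNe] at h3
  rw [finrank_eq_two_mul_card b] at h4
  omega

theorem IsMinusForm.hasWittIndex : HasWittIndex Q (Fintype.card ι - 1) := by
  refine ⟨⟨spanInlNe b k, fun x hx => hQ.apply_eq_zero_of_mem_spanInlNe hb hβ hx,
    finrank_spanInlNe b k⟩, ?_⟩
  rintro d ⟨W, hW, rfl⟩
  exact Nat.le_sub_one_of_lt (hQ.finrank_lt_of_singular hb hβ hβ' hW)

theorem IsMinusForm.finrank_lt_of_singular_comp (g : V ≃ₗ[F] V) {W : Submodule F V}
    (hW : ∀ x ∈ W, Q (g x) = 0) : Module.finrank F W < Fintype.card ι := by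
  rw [← LinearEquiv.finrank_map_eq g W]
  refine hQ.finrank_lt_of_singular hb hβ hβ' ?_
  rintro _ ⟨x, hx, rfl⟩
  exact hW x hx

/-! ### The factorization -/

omit hQ [Finite F] in
/-- The transvection `x ↦ x + c β(a, x) a` with `a` in the span of the `eᵢ` lies in the unipotent
radical; its effect on a quadratic form with polar form `β` is to add a multiple of `β(a, x)²`. -/
theorem IsSymplecticBasis.exists_transvection {Q' : QuadraticForm F V}
    (hQ' : ∀ x y, QuadraticMap.polar Q' x y = β x y) {a : V} (ha : a ∈ spanInl b) (c : F) :
    ∃ r ∈ isometryFixator β (spanInl b),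
      ∀ x, Q' (r x) = Q' x + (c + c ^ 2 * Q' a) * β a x ^ 2 := by
  have hfd : FiniteDimensional F V := b.finiteDimensional_of_finite
  let φ : V →ₗ[F] V := LinearMap.id + c • (β a).smulRight a
  have hφ : ∀ x, φ x = x + (c * β a x) • a := fun x => by simp [φ, mul_smul]
  obtain ⟨r, hrG, hr⟩ := exists_mem_bilinIsometryGroup hβ' φ fun x y => by
    rw [hφ, hφ]
    simp only [map_add, map_smul, LinearMap.add_apply, LinearMap.smul_apply, smul_eq_mul,
      hβ.self_eq_zero a]
    rw [bilin_comm hβ x a]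
    linear_combination CharTwo.add_self_eq_zero (c * β a x * β a y)
  refine ⟨r, ⟨hrG, fun x hx => ?_⟩, fun x => ?_⟩
  · rw [hr, hφ, (hb.mem_spanInl_iff hβ).1 ha x hx, mul_zero, zero_smul, add_zero]
  · rw [hr, hφ, quadraticForm_add hQ', QuadraticMap.map_smul, map_smul, smul_eq_mul, smul_eq_mul,
      bilin_comm hβ x a]
    ring

/-- A quadratic form `Q'` with the same polar form as `Q`, the same restriction to the span `U` of
the `eᵢ`, and no totally singular subspace of dimension `m` is the image of `Q` under an element of
the unipotent radical. Indeed `Q = Q' + β(a, ·)²` with `a ∈ U`, and a transvection `x + c β(a, x) a`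
works as soon as `c + c² Q(a) = 1`. For `Q(a) ≠ 0` this asks that `Q(a)` be of the form
`t + t²`. It is, as the sum of `Q(fₖ)` and `Q'(fₖ)`, which are both not of this form. -/
theorem IsMinusForm.exists_isometryFixator {Q' : QuadraticForm F V}
    (hQ' : ∀ x y, QuadraticMap.polar Q' x y = β x y)
    (hW : ∀ W : Submodule F V, (∀ x ∈ W, Q' x = 0) → Module.finrank F W < Fintype.card ι)
    (hU : ∀ x ∈ spanInl b, Q' x = Q x) :
    ∃ r ∈ isometryFixator β (spanInl b), ∀ x, Q' (r x) = Q x := by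
  have hfd : FiniteDimensional F V := b.finiteDimensional_of_finite
  obtain ⟨δ, hδ⟩ := exists_linearMap_sq (F := F) (fun x => Q x - Q' x)
    (fun x y => by rw [quadraticForm_add hQ.polar, quadraticForm_add hQ']; ring)
    (fun c x => by
      rw [QuadraticMap.map_smul, QuadraticMap.map_smul, smul_eq_mul, smul_eq_mul]; ring)
  obtain ⟨a, ha, hδa⟩ := hb.exists_eq_apply hβ δ fun x hx => by
    have := hδ x
    rw [hU x hx, sub_self] at this
    exact pow_eq_zero_iff two_ne_zero |>.1 this.symm
  have hQa : Q' a = Q a := hU a ha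
  have hfk : Q' (b (Sum.inr k)) = σ + Q a := by
    have := hδ (b (Sum.inr k))
    rw [hδa, hb.apply_inr, ← hQ.apply_of_mem_spanInl hb hβ ha, hQ.inr, if_pos rfl,
      CharTwo.sub_eq_add] at this
    linear_combination this - CharTwo.add_self_eq_zero σ
  have hne : ∀ t : F, t + t ^ 2 ≠ σ + Q a := by
    -- otherwise `⟨eᵢ : i ≠ k⟩` and `fₖ + t eₖ` span a totally singular subspace of dimension `m`
    intro t ht
    set v := b (Sum.inr k) + t • b (Sum.inl k) with hv
    have hQv : Q' v = 0 := by
      rw [hv, quadraticForm_add hQ', hfk, QuadraticMap.map_smul, hU _ (inl_mem_spanInl b k),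
        hQ.inl, if_pos rfl, map_smul, hb.inr_inl hβ, if_pos rfl, smul_eq_mul, smul_eq_mul, ← ht]
      linear_combination CharTwo.add_self_eq_zero (t + t ^ 2)
    have hvE : v ∉ spanInlNe b k := fun h => by
      have := (mem_spanInl_iff_repr b).1 (mem_spanInlNe_iff.1 h).1 k
      simp [hv] at this
    have hsing : ∀ x ∈ spanInlNe b k ⊔ Submodule.span F {v}, Q' x = 0 := by
      intro x hx
      obtain ⟨y, hy, z, hz, rfl⟩ := Submodule.mem_sup.1 hx
      obtain ⟨c, rfl⟩ := Submodule.mem_span_singleton.1 hz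
      obtain ⟨hyU, hyk⟩ := mem_spanInlNe_iff.1 hy
      rw [quadraticForm_add hQ', hU y hyU, hQ.apply_eq_zero_of_mem_spanInlNe hb hβ hy,
        QuadraticMap.map_smul, hQv, hv, map_smul, map_add, hb.apply_inr, hyk, map_smul,
        hb.apply_inl hβ, (mem_spanInl_iff_repr b).1 hyU]
      simp
    have h1 := Submodule.finrank_sup_span_singleton hvE
    have h2 := hW _ hsing
    rw [finrank_spanInlNe] at h1
    omega
  obtain ⟨c, hc⟩ : ∃ c : F, c + c ^ 2 * Q a = 1 := by
    obtain ⟨t, ht⟩ := exists_add_sq_eq_add hQ.add_sq_ne hne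
    rw [← add_assoc, CharTwo.add_self_eq_zero, zero_add] at ht
    by_cases h0 : Q a = 0
    · exact ⟨1, by rw [h0]; ring⟩
    · refine ⟨t / Q a, ?_⟩
      field_simp
      linear_combination ht
  obtain ⟨r, hr, hrQ⟩ := hb.exists_transvection hβ hβ' hQ' ha c
  refine ⟨r, hr, fun x => ?_⟩
  rw [hrQ, hQa, hc, one_mul, ← hδa, ← hδ]
  ring

/-- The factorization of the symplectic group. The restriction of a form of minus type to `U` is
the square of a nonzero linear form, and a Singer cycle is transitive on these, so that `g⁻¹` can
be corrected by a Singer cycle to preserve the restriction of `Q` to `U`; the unipotent radical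
does the rest. -/
theorem IsMinusForm.exists_mul_mem_quadIsometryGroup {L : Type*} [Field L] [Algebra F L]
    (ψ : L ≃ₗ[F] spanInl b) {S : Subgroup (V ≃ₗ[F] V)}
    (hS : S ≤ bilinIsometryGroup β)
    (hψ : ∀ a : L, a ≠ 0 → ∃ s ∈ S, ∀ x : L, s (ψ x : V) = (ψ (a * x) : V))
    {g : V ≃ₗ[F] V} (hg : g ∈ bilinIsometryGroup β) :
    ∃ s ∈ S, ∃ r ∈ isometryFixator β (spanInl b), g⁻¹ * s * r ∈ quadIsometryGroup Q := by
  have hfd : FiniteDimensional F V := b.finiteDimensional_of_finite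
  have hfdL : FiniteDimensional F L := ψ.symm.finiteDimensional
  have hform : ∀ h ∈ bilinIsometryGroup β, ∃ μ : L →ₗ[F] F, μ ≠ 0 ∧
      ∀ x, Q (h (ψ x)) = μ x ^ 2 := by
    intro h hh
    obtain ⟨μ, hμ⟩ := exists_linearMap_sq_of_isotropic
      (polar_comp_of_mem_bilinIsometryGroup hQ.polar hh)
      (fun x hx y hy => (hb.mem_spanInl_iff hβ).1 hx y hy)
    refine ⟨μ.comp (ψ : L →ₗ[F] spanInl b), fun h0 => ?_, fun x => hμ (ψ x)⟩
    have := hQ.finrank_lt_of_singular_comp hb hβ hβ' h (W := spanInl b) fun x hx => by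
      have h1 := hμ ⟨x, hx⟩
      have h2 := LinearMap.congr_fun h0 (ψ.symm ⟨x, hx⟩)
      rw [LinearMap.comp_apply, LinearEquiv.coe_coe, LinearEquiv.apply_symm_apply,
        LinearMap.zero_apply] at h2
      rw [h2, sq, zero_mul] at h1
      exact h1
    rw [finrank_spanInl] at this
    exact this.false
  obtain ⟨μ, hμ0, hμ⟩ := hform g⁻¹ (inv_mem hg)
  obtain ⟨ν, hν0, hν⟩ := hform 1 (one_mem _)
  obtain ⟨a, ha0, ha⟩ := exists_mul_eq_of_linearForm hμ0 hν0
  obtain ⟨s, hs, hsψ⟩ := hψ a ha0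
  obtain ⟨r, hr, hrQ⟩ := hQ.exists_isometryFixator hb hβ hβ'
    (Q' := Q.comp ((g⁻¹ * s : V ≃ₗ[F] V) : V →ₗ[F] V))
    (polar_comp_of_mem_bilinIsometryGroup hQ.polar (mul_mem (inv_mem hg) (hS hs)))
    (fun W hW => hQ.finrank_lt_of_singular_comp hb hβ hβ' (g⁻¹ * s) hW)
    (fun x hx => by
      obtain ⟨y, hy⟩ := ψ.surjective ⟨x, hx⟩
      obtain rfl : x = ψ y := by rw [hy]
      change Q (g⁻¹ (s (ψ y))) = Q (ψ y)
      rw [hsψ, hμ, ha, ← hν]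
      rfl)
  exact ⟨s, hs, r, hr, hrQ⟩

end

end MinusType

/-! ### The symplectic group as a product of a solvable group and an orthogonal group -/

theorem proposition5p4
    {F : Type*} {V : Type v} [Field F] [Finite F] [CharP F 2] [AddCommGroup V] [Module F V]
    (m : ℕ) (hm : 2 ≤ m)
    -- a nondegenerate symplectic form with a symplectic basis `e₁, …, eₘ, f₁, …, fₘ`
    (β : LinearMap.BilinForm F V) (hβ : β.IsAlt) (hβ' : β.Nondegenerate)
    (b : Module.Basis (Fin m ⊕ Fin m) F V)
    (e f : Fin m → V) (he : ∀ i, e i = b (Sum.inl i)) (hf : ∀ i, f i = b (Sum.inr i))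
    (hee : ∀ i j, β (e i) (e j) = 0) (hff : ∀ i j, β (f i) (f j) = 0)
    (hef : ∀ i j, β (e i) (f j) = if i = j then 1 else 0)
    -- the quadratic form of minus type
    (σ : F) (hσ : Irreducible (X ^ 2 + X + C σ : F[X]))
    (Q : QuadraticForm F V) (hQ : ∀ x y, QuadraticMap.polar Q x y = β x y)
    (hQe : ∀ i : Fin m, Q (e i) = if (i : ℕ) + 1 = m then 1 else 0)
    (hQf : ∀ i : Fin m, Q (f i) = if (i : ℕ) + 1 = m then σ else 0)
    -- the groups `G = Sp(V, β)`, `K = GO(V, Q)`, the parabolic `A`, its unipotent radical `R`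
    (G K A R : Subgroup (V ≃ₗ[F] V)) (U : Submodule F V)
    (hG : G = bilinIsometryGroup β) (hK : K = quadIsometryGroup Q)
    (hU : U = Submodule.span F (Set.range e)) (hA : A = G ⊓ subspaceStabilizer U)
    (hR : R = pCore 2 A) :
    HasWittIndex Q (m - 1) ∧
    -- the stabilizer of `⟨e₁, …, eₘ⟩` and `⟨f₁, …, fₘ⟩` is a Levi factor
    IsSplitExtension A R (A ⊓ subspaceStabilizer (Submodule.span F (Set.range f))) ∧
    -- any Levi factor `C` is identified with `GL(U) = GL_m(q)` by its action on `U`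
    ∀ C : Subgroup (V ≃ₗ[F] V), IsSplitExtension A R C →
      (∀ u : U ≃ₗ[F] U, ∃! g : V ≃ₗ[F] V, g ∈ C ∧ ∀ x : U, g (x : V) = (u x : V)) ∧
      (∃ S : Subgroup (V ≃ₗ[F] V), IsSingerCycleVia U C S) ∧
      ∀ S H : Subgroup (V ≃ₗ[F] V), IsSingerCycleVia U C S → H = R ⊔ S →
        H ≤ A ∧ IsSplitExtension H R S ∧
        (IsMulCommutative R ∧ (∀ r ∈ R, r ^ 2 = 1) ∧
          Nat.card R = Nat.card F ^ (m * (m + 1) / 2)) ∧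
        (∀ (L : Type) [Field L], Nat.card L = Nat.card F ^ m →
          Nonempty (S ≃* Matrix.GeneralLinearGroup (Fin 1) L)) ∧
        Group.IsSolvable H ∧
        (G : Set (V ≃ₗ[F] V)) = (H : Set (V ≃ₗ[F] V)) * (K : Set (V ≃ₗ[F] V)) := by
  obtain rfl : e = fun i => b (Sum.inl i) := funext he
  obtain rfl : f = fun i => b (Sum.inr i) := funext hf
  have hU' : U = spanInl b := hU
  subst hU' hG hK
  have hb : IsSymplecticBasis β b := ⟨hee, hff, hef⟩
  have hm0 : 0 < m := by omega
  let k : Fin m := ⟨m - 1, by omega⟩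
  have hk : ∀ i : Fin m, (i : ℕ) + 1 = m ↔ i = k := fun i => by
    rw [Fin.ext_iff]
    change _ ↔ (i : ℕ) = m - 1
    omega
  have hmin : IsMinusForm Q β b k σ :=
    ⟨hQ, fun i => by simp only [hQe, hk], fun i => by simp only [hQf, hk],
      add_sq_ne_of_irreducible hσ⟩
  have hR' : R = isometryFixator β (spanInl b) := by rw [hR, hA, hb.pCore_two hβ hβ']
  clear hR
  subst hR' hA
  have : FiniteDimensional F V := b.finiteDimensional_of_finite
  have hfin : Module.finrank F (spanInl b) = m := by rw [finrank_spanInl, Fintype.card_fin]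
  have : Nontrivial (spanInl b) := Module.nontrivial_of_finrank_pos (R := F) <| by
    rw [hfin]; exact hm0
  refine ⟨by simpa using hmin.hasWittIndex hb hβ hβ', hb.isSplitExtension hβ hβ', fun C hC => ?_⟩
  have hCu := hb.existsUnique_mem_complement hβ hβ' hC
  refine ⟨hCu, exists_isSingerCycleVia (spanInl b) C, ?_⟩
  rintro S H hS rfl
  obtain ⟨L, _, _, ψ, hψ, ⟨E⟩⟩ := hS.exists_field hCu
  have hfdL : FiniteDimensional F L := ψ.symm.finiteDimensional
  have hSA := hS.1.trans hC.2.1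
  have hHA : isometryFixator β (spanInl b) ⊔ S ≤
      bilinIsometryGroup β ⊓ subspaceStabilizer (spanInl b) :=
    sup_le (isometryFixator_le β _) hSA
  have hsplit := hC.sup_of_le hS.1
  have hcomm : ∀ r s : isometryFixator β (spanInl b), r * s = s * r := fun r s =>
    Subtype.ext (hb.mul_comm_of_mem_isometryFixator hβ r.2 s.2)
  refine ⟨hHA, hsplit, ⟨⟨⟨hcomm⟩⟩, fun r hr => hb.sq_eq_one_of_mem_isometryFixator hβ hr, ?_⟩,
    fun L' _ hL' => ?_, ?_, Set.Subset.antisymm (fun g hg => ?_) ?_⟩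
  · simpa using hb.card_isometryFixator hβ hβ'
  · obtain ⟨E'⟩ := nonempty_mulEquiv_generalLinearGroup_one (F := F) (L := L) (L' := L')
      (by rw [hL', LinearEquiv.finrank_eq ψ, hfin])
    exact ⟨E.trans E'⟩
  · exact hsplit.isSolvable (Group.isSolvable_of_comm hcomm)
      (Group.isSolvable_of_surjective (f := E.symm.toMonoidHom) E.symm.surjective)
  · obtain ⟨s, hs, r, hr, hsr⟩ := hmin.exists_mul_mem_quadIsometryGroup hb hβ hβ' ψ
      (hSA.trans inf_le_left) hψ hg
    exact ⟨s * r, mul_mem (Subgroup.mem_sup_right hs) (Subgroup.mem_sup_left hr),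
      (g⁻¹ * s * r)⁻¹, inv_mem hsr, by group⟩
  · rintro _ ⟨h, hh, x, hx, rfl⟩
    exact mul_mem (hHA hh).1 (quadIsometryGroup_le hQ hx)
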